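/- Let $G_2\subset\mathbb R^2$ be a smooth bounded domain, $h>0$, $G=G_2\times(-h,0)$, with points written $x=(x',z)$, and let $\nu>0$, $T>0$. Write $\Gamma_b=G_2\times\{-h\}$, $\Gamma_s=\partial G_2\times[-h,0]$, $\Gamma_t=G_2\times\{0\}$, and let $\nabla_2,\operatorname{div}_2$ be the gradient and divergence in $x'$. Let $C^\infty_{b,s}(G)$ be the set of $\mathbb R^2$-valued fields on $G$, smooth up to $\Gamma_t$, with compact support in $\overline G\setminus(\Gamma_b\cup\Gamma_s)$, and $$\mathcal V=\Big\{v\in C^\infty_{b,s}(G):\ \operatorname{div}_2\int_{-h}^0 v\,dz=0\ \text{on } G_2\Big\}.$$ Let $H$ and $V$ be the closures of $\mathcal V$ in $L^2(G)^2$ and in $H^1(G)^2$, and let $\Pi_H$ be the orthogonal projection of $L^2(G)^2$ onto $H$. Let $A=-\Pi_H\Delta$, with domain $D(A)$ the set of $v\in V$ with $\Delta v\in L^2(G)^2$ and $\partial_z v=0$ on $\Gamma_t$ in the weak sense, i.e. $\int_G\nabla v:\nabla\varphi\,dx=-\int_G\Delta v\cdot\varphi\,dx$ for all $\varphi\in C^\infty_{b,s}(G)$;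 $D(A)$ carries the norm $\|Av\|_{L^2}$. Let $f,v_0\in H$, with $f$ independent of time. A strong solution of the primitive equations on $[0,T]$ with force $f$ and initial value $v_0$ is a function $v\in L^\infty([0,T];V)\cap L^2([0,T];D(A))$ with weak time derivative $\partial_t v\in L^2([0,T];H)$ such that, for some pressure $p=p(x',t)$ with $p(\cdot,t)\in H^1(G_2)$, $$\partial_t v-\nu\Delta v+(v\cdot\nabla_2)v-\Big(\int_{-h}^z\operatorname{div}_2 v(x',z',t)\,dz'\Big)\partial_z v+\nabla_2 p=f\quad\text{for a.e. } t\in[0,T] \text{ and a.e. } x\in G,$$ and $v(0)=v_0$, in the sense that $v(t)\to v_0$ in $L^2(G)^2$ as $t\to0^+$ outside some null set of times. Theorem. If $v$ is a strong solution on $[0,T]$ with initial value $v_0$, then $v\in C([0,T];V)$; that is, there is a continuous $u:[0,T]\to V$ with $u(t)=v(t)$ for almost every $t\in[0,T]$, and $u(0)=v_0$. -/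

import Mathlib

open MeasureTheory Set Filter Topology
open scoped ContDiff

noncomputable section

namespace PrimitiveEq

/-- The Euclidean plane: the horizontal variable `x'` and the horizontal velocity live here. -/
abbrev Plane := EuclideanSpace ℝ (Fin 2)

/-- Three-dimensional space, a point being written `x = (x', z)`. Its volume is Lebesgue measure. -/
abbrev Space := Plane × ℝ

/-- A smooth bounded domain of the plane: a nonempty bounded connected open set that near each of
its boundary points is the sublevel set `{ρ < 0}` of a smooth function with `dρ ≠ 0`. -/
structure IsSmoothBoundedDomain (G₂ : Set Plane) : Prop where
  isOpen : IsOpen G₂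
  isConnected : IsConnected G₂
  isBounded : Bornology.IsBounded G₂
  smooth_boundary : ∀ a ∈ frontier G₂, ∃ U : Set Plane, IsOpen U ∧ a ∈ U ∧
    ∃ ρ : Plane → ℝ, ContDiffOn ℝ ∞ ρ U ∧ fderiv ℝ ρ a ≠ 0 ∧ G₂ ∩ U = {x ∈ U | ρ x < 0}

/-- The cylinder `G = G₂ × (-h, 0)`. -/
def cylinder (G₂ : Set Plane) (h : ℝ) : Set Space := G₂ ×ˢ Ioo (-h) 0

/-- Lebesgue measure on the cylinder `G`. -/
abbrev vol (G₂ : Set Plane) (h : ℝ) : Measure Space := volume.restrict (cylinder G₂ h)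

/-- The Hilbert space `L²(G)` of horizontal vector fields. -/
abbrev L2 (G₂ : Set Plane) (h : ℝ) := Lp Plane 2 (vol G₂ h)

/-- The unit vectors of the `x₁`, `x₂` and `z` axes. -/
def axis : Fin 3 → Space :=
  ![(EuclideanSpace.single 0 1, 0), (EuclideanSpace.single 1 1, 0), (0, 1)]

/-- The fields of `C^∞_{b,s}(G)`: smooth up to the top, with compact support in the closure of `G`
minus the bottom `G₂ × {-h}` and the sides `∂G₂ × [-h, 0]`. Such a field on `G` is the restriction
of a smooth compactly supported field on the open set `G₂ × (-h, ∞)`, which is how it is given. -/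
structure IsTestField (G₂ : Set Plane) (h : ℝ) (φ : Space → Plane) : Prop where
  smooth : ContDiff ℝ ∞ φ
  compact : HasCompactSupport φ
  support : tsupport φ ⊆ G₂ ×ˢ Ioi (-h)

/-- The class `𝒱`: fields of `C^∞_{b,s}(G)` with `div₂ ∫_{-h}^0 φ dz = 0` on `G₂`. -/
structure IsSmoothField (G₂ : Set Plane) (h : ℝ) (φ : Space → Plane) : Prop
    extends IsTestField G₂ h φ where
  div_eq_zero : ∀ y ∈ G₂,
    ∑ i : Fin 2, fderiv ℝ (fun y' : Plane => ∫ z in (-h)..0, φ (y', z) i) y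
      (EuclideanSpace.single i 1) = 0

/-- `H`, the closure of `𝒱` in `L²(G)`. (`𝒱` is a linear space, so the span adds nothing.) -/
def H (G₂ : Set Plane) (h : ℝ) : Submodule ℝ (L2 G₂ h) :=
  (Submodule.span ℝ {g : L2 G₂ h | ∃ φ, IsSmoothField G₂ h φ ∧ g =ᵐ[vol G₂ h] φ}).topologicalClosure

instance (G₂ : Set Plane) (h : ℝ) : CompleteSpace (H G₂ h) := by
  unfold H; infer_instance

/-- Pairs `(v, (∂₁v, ∂₂v, ∂_z v))` of `L²` fields; the Hilbert norm is the `H¹` norm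
`(‖v‖² + ∑ ‖∂ᵢ v‖²)^(1/2)`. -/
abbrev Jet (G₂ : Set Plane) (h : ℝ) := WithLp 2 (L2 G₂ h × PiLp 2 (fun _ : Fin 3 => L2 G₂ h))

/-- `V`, the closure of `𝒱` in `H¹(G)`; an element is given together with its (weak) gradient. -/
def V (G₂ : Set Plane) (h : ℝ) : Submodule ℝ (Jet G₂ h) :=
  (Submodule.span ℝ {u : Jet G₂ h | ∃ φ, IsSmoothField G₂ h φ ∧ u.fst =ᵐ[vol G₂ h] φ ∧
    ∀ i, u.snd i =ᵐ[vol G₂ h] fun x => fderiv ℝ φ x (axis i)}).topologicalClosure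

instance (G₂ : Set Plane) (h : ℝ) : CompleteSpace (V G₂ h) := by
  unfold V; infer_instance

/-- The field underlying an element of `V`. -/
def V.field {G₂ : Set Plane} {h : ℝ} (u : V G₂ h) : L2 G₂ h := (u : Jet G₂ h).fst

/-- The partial derivatives `∂₁u, ∂₂u, ∂_z u` of an element of `V`. -/
def V.grad {G₂ : Set Plane} {h : ℝ} (u : V G₂ h) (i : Fin 3) : L2 G₂ h := (u : Jet G₂ h).snd i

/-- `g = Δu` weakly in `G` and `∂_z u = 0` on the top `G₂ × {0}`. Both are contained in Green's
formula `∫_G ∇u : ∇φ = - ∫_G g · φ` for all `φ` that vanish near the bottom and the sides. -/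
def IsLaplacian {G₂ : Set Plane} {h : ℝ} (u : V G₂ h) (g : L2 G₂ h) : Prop :=
  ∀ φ : Space → Plane, IsTestField G₂ h φ →
    ∑ i : Fin 3, ∫ x in cylinder G₂ h, inner ℝ (V.grad u i x) (fderiv ℝ φ x (axis i)) =
      - ∫ x in cylinder G₂ h, inner ℝ (g x) (φ x)

/-- The domain `D(A)`: the `u ∈ V` with `Δu ∈ L²(G)` and `∂_z u = 0` on the top. -/
def domA (G₂ : Set Plane) (h : ℝ) : Set (V G₂ h) := {u | ∃ g, IsLaplacian u g}

open Classical in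
/-- The Laplacian of `u ∈ D(A)` (and `0` outside `D(A)`). -/
def lap {G₂ : Set Plane} {h : ℝ} (u : V G₂ h) : L2 G₂ h :=
  if hu : ∃ g, IsLaplacian u g then hu.choose else 0

/-- The operator `A = -Π_H Δ`, where `Π_H` is the orthogonal projection of `L²(G)` onto `H`. -/
def opA {G₂ : Set Plane} {h : ℝ} (u : V G₂ h) : H G₂ h :=
  - (H G₂ h).orthogonalProjectionOnto (lap u)

/-- `(u · ∇₂) u - (∫_{-h}^z div₂ u dz') ∂_z u` at the point `x = (x', z)`. -/
def advection {G₂ : Set Plane} {h : ℝ} (u : V G₂ h) (x : Space) : Plane :=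
  V.field u x 0 • V.grad u 0 x + V.field u x 1 • V.grad u 1 x -
    (∫ z' in (-h)..x.2, (V.grad u 0 (x.1, z') 0 + V.grad u 1 (x.1, z') 1)) • V.grad u 2 x

/-- `p ∈ H¹(G₂)` with weak gradient `q`. -/
structure HasH1Gradient (G₂ : Set Plane) (p : Plane → ℝ) (q : Plane → Plane) : Prop where
  memLp : MemLp p 2 (volume.restrict G₂)
  memLp_grad : MemLp q 2 (volume.restrict G₂)
  weak : ∀ ψ : Plane → ℝ, ContDiff ℝ ∞ ψ → HasCompactSupport ψ → tsupport ψ ⊆ G₂ →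
    ∀ i, ∫ y in G₂, p y * fderiv ℝ ψ y (EuclideanSpace.single i 1) = - ∫ y in G₂, q y i * ψ y

/-- `w` is the weak (distributional) derivative of `v` on the time interval `(0, T)`. -/
def IsWeakTimeDeriv {E : Type*} [NormedAddCommGroup E] [NormedSpace ℝ E] (T : ℝ)
    (v w : ℝ → E) : Prop :=
  ∀ η : ℝ → ℝ, ContDiff ℝ ∞ η → HasCompactSupport η → tsupport η ⊆ Ioo 0 T →
    ∫ t in Ioo 0 T, deriv η t • v t = - ∫ t in Ioo 0 T, η t • w t

/-- `v` is a strong solution on `[0, T]` of the primitive equations with viscosity `ν`, force `f`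
and initial value `v₀`: `v ∈ L^∞([0,T]; V) ∩ L²([0,T]; D(A))`, `∂ₜv ∈ L²([0,T]; H)`, for some
pressure `p = p(x', t)` the equation holds almost everywhere, and `v(0) = v₀`. As `v` is only given
up to null sets of times, `v(0)` is the essential limit of `v(t)` in `L²(G)` as `t` tends to `0`. -/
structure IsStrongSolution (G₂ : Set Plane) (h ν T : ℝ) (f v₀ : H G₂ h) (v : ℝ → V G₂ h) :
    Prop where
  memLp_top : MemLp v ⊤ (volume.restrict (Icc 0 T))
  mem_domA : ∀ᵐ t ∂(volume.restrict (Icc 0 T)), v t ∈ domA G₂ h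
  memLp_opA : MemLp (fun t => opA (v t)) 2 (volume.restrict (Icc 0 T))
  equation : ∃ w : ℝ → H G₂ h, MemLp w 2 (volume.restrict (Icc 0 T)) ∧
    IsWeakTimeDeriv T (fun t => V.field (v t)) (fun t => (w t : L2 G₂ h)) ∧
    ∃ (p : ℝ → Plane → ℝ) (q : ℝ → Plane → Plane), ∀ᵐ t ∂(volume.restrict (Icc 0 T)),
      HasH1Gradient G₂ (p t) (q t) ∧
      ∀ᵐ x ∂(vol G₂ h),
        (w t : L2 G₂ h) x - ν • lap (v t) x + advection (v t) x + q t x.1 = (f : L2 G₂ h) x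
  initial : Tendsto (fun t => V.field (v t)) (𝓝[>] (0 : ℝ) ⊓ ae volume) (𝓝 (v₀ : L2 G₂ h))

end PrimitiveEq

end

/-! Continuity in `V` follows from the regularity class: both `Av` and `∂ₜv = w` are square
integrable in time. Green's formula on `𝒱` and density give `⟪v, φ⟫_V = ⟪b, φ⟫_{L²}` with `b = v +
Av` (`inner_eq_inner_field_add_opA`), and `v` is a primitive of `w` in `L²(G)`
(`IsWeakTimeDeriv.ae_eq_const_add_integral`). Symmetry of the inner product then gives, for almost
all `s < t`, `‖v t‖² - ‖v s‖² = ⟪b t + b s, ∫_s^t w⟫`, an energy identity that needs no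
mollification.

By Cauchy–Schwarz and Young the right side is at most `(t - s)(‖b s‖² + ‖b t‖²) + ∫_s^t ‖w‖²`. The
values of `b` are not controlled pointwise, so the bound is averaged over short shifts
(`sub_le_two_mul_integral_of_increment_le`); thus `‖v‖²` has the modulus of continuity of `∫ (2‖b‖²
+ ‖w‖²)`. Finally `‖v t - v s‖²` is the increment of `‖v‖²` minus `2⟪b s, ∫_s^t w⟫`, which is small
when `s` is a time where `‖b s‖²` is at most its local average. So `v` is Cauchy along a set of full
measure and extends continuously (`exists_continuousOn_of_inner_eq`). -/

namespace PrimitiveEq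

/-! ### Weak derivatives in time and primitives -/

section WeakTimeDerivative

variable {E : Type*} [NormedAddCommGroup E] [NormedSpace ℝ E]

/-- The primitive of an integrable function has that function as its weak derivative. -/
theorem isWeakTimeDeriv_integral [CompleteSpace E] {T : ℝ} {w : ℝ → E}
    (hw : IntegrableOn w (Ioo 0 T)) :
    IsWeakTimeDeriv T (fun t => ∫ s in (0 : ℝ)..t, w s) w := by
  intro η hη hc hs
  set μ : Measure ℝ := volume.restrict (Ioo 0 T) with hμ
  have hd : Continuous (deriv η) := hη.continuous_deriv (by simp)
  have hdi : Integrable (deriv η) μ :=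
    (hd.integrable_of_hasCompactSupport hc.deriv).integrableOn
  -- Fubini on the triangle `s < t`: integrating in `s` first gives `η'` times the primitive;
  -- integrating in `t` first gives `-η w`, as `η T = 0`.
  have hF : Integrable (Function.uncurry fun t s : ℝ =>
      {p : ℝ × ℝ | p.2 < p.1}.indicator (fun p => deriv η p.1 • w p.2) (t, s)) (μ.prod μ) :=
    (hdi.smul_prod hw).indicator (measurableSet_lt measurable_snd measurable_fst)
  have hswap := integral_integral_swap hF
  have h0 : ∀ t, t ∉ Ioo 0 T → η t = 0 := fun t ht =>
    image_eq_zero_of_notMem_tsupport fun h' => ht (hs h')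
  have hl : ∀ t ∈ Ioo 0 T, (∫ s, {p : ℝ × ℝ | p.2 < p.1}.indicator
      (fun p => deriv η p.1 • w p.2) (t, s) ∂μ) = deriv η t • ∫ s in (0 : ℝ)..t, w s := by
    intro t ht
    have : (fun s => {p : ℝ × ℝ | p.2 < p.1}.indicator
        (fun p => deriv η p.1 • w p.2) (t, s)) = (Iio t).indicator fun s => deriv η t • w s := by
      ext s; simp [indicator]
    rw [this, integral_indicator measurableSet_Iio, hμ, Measure.restrict_restrict measurableSet_Iio,
      integral_smul, intervalIntegral.integral_of_le ht.1.le, integral_Ioc_eq_integral_Ioo]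
    congr 3
    ext x
    simp only [mem_inter_iff, mem_Iio, mem_Ioo]
    constructor
    · rintro ⟨h1, h2, -⟩; exact ⟨h2, h1⟩
    · rintro ⟨h1, h2⟩; exact ⟨h2, h1, h2.trans ht.2⟩
  have hr : ∀ s ∈ Ioo 0 T, (∫ t, {p : ℝ × ℝ | p.2 < p.1}.indicator
      (fun p => deriv η p.1 • w p.2) (t, s) ∂μ) = - (η s • w s) := by
    intro s hsT
    have : (fun t => {p : ℝ × ℝ | p.2 < p.1}.indicator
        (fun p => deriv η p.1 • w p.2) (t, s)) = (Ioi s).indicator fun t => deriv η t • w s := by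
      ext t; simp [indicator]
    have hI : Ioi s ∩ Ioo 0 T = Ioo s T := by
      ext x
      simp only [mem_inter_iff, mem_Ioi, mem_Ioo]
      constructor
      · rintro ⟨h1, -, h2⟩; exact ⟨h1, h2⟩
      · rintro ⟨h1, h2⟩; exact ⟨h1, hsT.1.trans h1, h2⟩
    rw [this, integral_indicator measurableSet_Ioi, hμ, Measure.restrict_restrict measurableSet_Ioi,
      integral_smul_const, hI, ← integral_Ioc_eq_integral_Ioo,
      ← intervalIntegral.integral_of_le hsT.2.le,
      intervalIntegral.integral_deriv_eq_sub
        (fun x _ => (hη.differentiable (by simp)).differentiableAt)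
        (hd.intervalIntegrable _ _), h0 T (by simp), zero_sub, neg_smul]
  rw [setIntegral_congr_fun measurableSet_Ioo hl, setIntegral_congr_fun measurableSet_Ioo hr,
    integral_neg] at hswap
  exact hswap

/-- du Bois-Reymond: a function with vanishing weak derivative is constant. -/
theorem ae_eq_const_of_isWeakTimeDeriv_zero [CompleteSpace E] {T : ℝ} (hT : 0 < T) {u : ℝ → E}
    (hu : IntegrableOn u (Ioo 0 T)) (h0 : IsWeakTimeDeriv T u fun _ => 0) :
    ∃ c : E, ∀ᵐ t, t ∈ Ioo 0 T → u t = c := by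
  let B : ContDiffBump (T / 2) := ⟨T / 8, T / 4, by positivity, by linarith⟩
  let ρ : ℝ → ℝ := B.normed volume
  have hρ : ContDiff ℝ ∞ ρ := B.contDiff_normed
  have hρc : HasCompactSupport ρ := B.hasCompactSupport_normed
  have hρs : tsupport ρ ⊆ Ioo 0 T := by
    rw [B.tsupport_normed_eq, Real.closedBall_eq_Icc]
    intro x hx
    simp only [mem_Icc, B] at hx
    constructor <;> linarith [hx.1, hx.2]
  have hρ1 : ∫ x, ρ x = 1 := B.integral_normed
  refine ⟨∫ t in Ioo 0 T, ρ t • u t, ?_⟩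
  set c := ∫ t in Ioo 0 T, ρ t • u t with hc
  have hmul : ∀ ψ : ℝ → ℝ, ContDiff ℝ ∞ ψ → HasCompactSupport ψ →
      IntegrableOn (fun t => ψ t • u t) (Ioo 0 T) := by
    intro ψ h1 h2
    obtain ⟨C, hC⟩ := h2.exists_bound_of_continuous h1.continuous
    exact hu.bdd_smul C h1.continuous.aestronglyMeasurable (Eventually.of_forall hC)
  have key := isOpen_Ioo.ae_eq_zero_of_integral_contDiff_smul_eq_zero (μ := volume)
    (f := fun t => u t - c) (U := Ioo 0 T)
    ((hu.sub (integrableOn_const (by simp))).locallyIntegrableOn) ?_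
  · filter_upwards [key] with t ht hm
    exact sub_eq_zero.1 (ht hm)
  intro ψ hψ hψc hψs
  -- Subtracting `m ρ` leaves a function of mean zero, hence the derivative of an admissible test
  -- function `η`. Testing with `η` gives `∫ ψ u = m c`.
  set m := ∫ x, ψ x with hm
  let θ : ℝ → ℝ := fun t => ψ t - m * ρ t
  have hθ : ContDiff ℝ ∞ θ := hψ.sub (contDiff_const.mul hρ)
  let K := tsupport ψ ∪ tsupport ρ
  have hK : IsCompact K := hψc.union hρc
  have hKs : K ⊆ Ioo 0 T := union_subset hψs hρs
  have hne : K.Nonempty := ⟨T / 2, Or.inr (by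
    rw [B.tsupport_normed_eq]; exact Metric.mem_closedBall_self (by simp [B]; positivity))⟩
  have hθ0 : ∀ t, t ∉ K → θ t = 0 := by
    intro t ht
    simp only [θ]
    rw [image_eq_zero_of_notMem_tsupport fun h' => ht (Or.inl h'),
      image_eq_zero_of_notMem_tsupport fun h' => ht (Or.inr h')]
    simp
  have ha : sInf K ∈ K := hK.sInf_mem hne
  have hb : sSup K ∈ K := hK.sSup_mem hne
  have hKI : K ⊆ Icc (sInf K) (sSup K) := fun x hx =>
    ⟨csInf_le hK.bddBelow hx, le_csSup hK.bddAbove hx⟩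
  have hψi : Integrable ψ := hψ.continuous.integrable_of_hasCompactSupport hψc
  have hρi : Integrable ρ := hρ.continuous.integrable_of_hasCompactSupport hρc
  have hθi : ∫ t, θ t = 0 := by
    rw [integral_sub hψi (hρi.const_mul m), integral_const_mul, hρ1, hm, mul_one, sub_self]
  let η : ℝ → ℝ := fun t => ∫ s in (0 : ℝ)..t, θ s
  have hηd : ∀ t, HasDerivAt η (θ t) t := fun t =>
    (hθ.continuous.integral_hasStrictDerivAt 0 t).hasDerivAt
  have hη' : deriv η = θ := funext fun t => (hηd t).deriv
  have hη : ContDiff ℝ ∞ η := by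
    rw [contDiff_infty_iff_deriv, hη']
    exact ⟨fun t => (hηd t).differentiableAt, hθ⟩
  have hη0 : ∀ t, t ∉ Icc (sInf K) (sSup K) → η t = 0 := by
    intro t ht
    rw [mem_Icc, not_and_or, not_le, not_le] at ht
    rcases ht with ht | ht
    · refine intervalIntegral.integral_zero_ae (Eventually.of_forall fun s hs => hθ0 s fun hsK => ?_)
      have h1 := (hKI hsK).1
      have h2 := (hKs ha).1
      rcases mem_uIoc.1 hs with h3 | h3 <;> linarith [h3.1, h3.2]
    · have ht0 : 0 ≤ t := ((hKs hb).1.trans ht).le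
      rw [← hθi, ← setIntegral_eq_integral_of_forall_compl_eq_zero (s := Ioc 0 t)]
      · exact intervalIntegral.integral_of_le ht0
      · intro s hs
        refine hθ0 s fun hsK => hs ⟨(hKs hsK).1, (hKI hsK).2.trans ht.le⟩
  have hηsub : tsupport η ⊆ Icc (sInf K) (sSup K) :=
    closure_minimal (fun t ht => by_contra fun h' => ht (hη0 t h')) isClosed_Icc
  have hηc : HasCompactSupport η := isCompact_Icc.of_isClosed_subset (isClosed_tsupport _) hηsub
  have hηs : tsupport η ⊆ Ioo 0 T := fun t ht =>
    ⟨(hKs ha).1.trans_le (hηsub ht).1, (hηsub ht).2.trans_lt (hKs hb).2⟩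
  have h1 := h0 η hη hηc hηs
  rw [hη'] at h1
  have h2 : ∫ t in Ioo 0 T, θ t • u t = (∫ t in Ioo 0 T, ψ t • u t) - m • c := by
    rw [hc, ← integral_smul]
    refine Eq.trans ?_ (integral_sub (hmul ψ hψ hψc) ((hmul ρ hρ hρc).smul m))
    simp only [θ, sub_smul, mul_smul]
  have h3 : ∫ t in Ioo 0 T, ψ t • u t = m • c := by
    rw [h2] at h1
    simpa [sub_eq_zero] using h1
  have h4 : ∫ t in Ioo 0 T, ψ t = m :=
    setIntegral_eq_integral_of_forall_compl_eq_zero fun t ht =>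
      image_eq_zero_of_notMem_tsupport fun h' => ht (hψs h')
  have h5 : ∫ t, ψ t • (u t - c) = ∫ t in Ioo 0 T, ψ t • (u t - c) :=
    (setIntegral_eq_integral_of_forall_compl_eq_zero fun t ht => by
      rw [image_eq_zero_of_notMem_tsupport fun h' => ht (hψs h'), zero_smul]).symm
  rw [h5]
  simp only [smul_sub]
  rw [integral_sub (hmul ψ hψ hψc) (hψi.integrableOn.smul_const c), integral_smul_const, h3, h4,
    sub_self]

/-- A function with integrable weak derivative `w` is a primitive of `w`. -/
theorem IsWeakTimeDeriv.ae_eq_const_add_integral [CompleteSpace E] {T : ℝ} (hT : 0 < T)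
    {u w : ℝ → E} (hu : IntegrableOn u (Ioo 0 T)) (hw : IntegrableOn w (Ioo 0 T))
    (huw : IsWeakTimeDeriv T u w) :
    ∃ c : E, ∀ᵐ t, t ∈ Ioo 0 T → u t = c + ∫ s in (0 : ℝ)..t, w s := by
  have hwi : IntervalIntegrable w volume 0 T := by
    rwa [intervalIntegrable_iff_integrableOn_Ioo_of_le hT.le]
  have hWc : ContinuousOn (fun t => ∫ s in (0 : ℝ)..t, w s) (Icc 0 T) := by
    simpa [uIcc_of_le hT.le] using
      intervalIntegral.continuousOn_primitive_interval' hwi left_mem_uIcc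
  have hW : IntegrableOn (fun t => ∫ s in (0 : ℝ)..t, w s) (Ioo 0 T) :=
    hWc.integrableOn_Icc.mono_set Ioo_subset_Icc_self
  have hz : IsWeakTimeDeriv T (fun t => u t - ∫ s in (0 : ℝ)..t, w s) fun _ => 0 := by
    intro η hη hc hs
    have hd : Continuous (deriv η) := hη.continuous_deriv (by simp)
    obtain ⟨C, hC⟩ := hc.deriv.exists_bound_of_continuous hd
    simp only [smul_sub]
    refine (integral_sub (hu.bdd_smul C hd.aestronglyMeasurable (Eventually.of_forall hC))
      (hW.bdd_smul C hd.aestronglyMeasurable (Eventually.of_forall hC))).trans ?_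
    have h1 := huw η hη hc hs
    have h2 := isWeakTimeDeriv_integral hw η hη hc hs
    simp only [Pi.smul_apply'] at h1 h2 ⊢
    rw [h1, h2]
    simp
  obtain ⟨c, hc⟩ := ae_eq_const_of_isWeakTimeDeriv_zero hT (hu.sub hW) hz
  refine ⟨c, hc.mono fun t ht hm => ?_⟩
  rw [← ht hm, Pi.sub_apply, sub_add_cancel]

end WeakTimeDerivative

/-! ### Energy estimate and continuity in an abstract Hilbert space -/

section Energy

/-- A locally integrable function whose increments over steps `δ` are at most
`δ (β τ + β (τ + δ))` grows between Lebesgue points by at most twice the integral of `β`. -/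
theorem sub_le_two_mul_integral_of_increment_le {γ β : ℝ → ℝ} (hγ : LocallyIntegrable γ)
    (hβ : LocallyIntegrable β) {a b s t : ℝ}
    (hinc : ∀ δ > 0, ∀ᵐ τ, a < τ → τ + δ < b → γ (τ + δ) - γ τ ≤ δ * (β τ + β (τ + δ)))
    (has : a < s) (hst : s < t) (htb : t < b)
    (hs : HasDerivAt (fun x => ∫ τ in (0 : ℝ)..x, γ τ) (γ s) s)
    (ht : HasDerivAt (fun x => ∫ τ in (0 : ℝ)..x, γ τ) (γ t) t) :
    γ t - γ s ≤ 2 * ∫ τ in s..t, β τ := by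
  have iγ : ∀ x y, IntervalIntegrable γ volume x y := fun x y =>
    intervalIntegrable_iff.2
      ((hγ.integrableOn_isCompact isCompact_uIcc).mono_set uIoc_subset_uIcc)
  have iβ : ∀ x y, IntervalIntegrable β volume x y := fun x y =>
    intervalIntegrable_iff.2
      ((hβ.integrableOn_isCompact isCompact_uIcc).mono_set uIoc_subset_uIcc)
  have hB : Continuous fun x => ∫ τ in (0 : ℝ)..x, β τ :=
    intervalIntegral.continuous_primitive iβ 0
  -- Integrated over `(s, t)`, the increments of `γ` telescope to integrals over `(t, t + δ)` and
  -- `(s, s + δ)`; divided by `δ` they tend to `γ t - γ s`. The two terms in `β` produce the factor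
  -- 2.
  have h1 := ht.tendsto_slope_zero_right.sub hs.tendsto_slope_zero_right
  have h2 : Tendsto (fun δ => (∫ τ in s..t, β τ) + ((∫ τ in (0 : ℝ)..(t + δ), β τ) -
      ∫ τ in (0 : ℝ)..(s + δ), β τ)) (𝓝[>] 0) (𝓝 (2 * ∫ τ in s..t, β τ)) := by
    have : Continuous fun δ => (∫ τ in s..t, β τ) + ((∫ τ in (0 : ℝ)..(t + δ), β τ) -
      ∫ τ in (0 : ℝ)..(s + δ), β τ) :=
      continuous_const.add ((hB.comp (continuous_const.add continuous_id)).sub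
        (hB.comp (continuous_const.add continuous_id)))
    have h3 := (this.tendsto 0).mono_left (nhdsWithin_le_nhds (s := Ioi 0))
    have h4 : (2 * ∫ τ in s..t, β τ) = (∫ τ in s..t, β τ) + ((∫ τ in (0 : ℝ)..(t + 0), β τ) -
        ∫ τ in (0 : ℝ)..(s + 0), β τ) := by
      rw [add_zero, add_zero, intervalIntegral.integral_interval_sub_left (iβ _ _) (iβ _ _)]
      ring
    rw [h4]
    exact h3
  refine le_of_tendsto_of_tendsto h1 h2 ?_
  have hev : ∀ᶠ δ in 𝓝[>] (0 : ℝ), δ ∈ Ioo 0 (b - t) := Ioo_mem_nhdsGT (by linarith)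
  filter_upwards [hev] with δ hδ
  have iγδ : IntervalIntegrable (fun τ => γ (τ + δ)) volume s t := by
    simpa using (iγ (s + δ) (t + δ)).comp_add_right δ
  have iβδ : IntervalIntegrable (fun τ => β (τ + δ)) volume s t := by
    simpa using (iβ (s + δ) (t + δ)).comp_add_right δ
  have hle : ∫ τ in s..t, (γ (τ + δ) - γ τ) ≤ ∫ τ in s..t, δ * (β τ + β (τ + δ)) := by
    refine intervalIntegral.integral_mono_ae_restrict hst.le
      (iγδ.sub (iγ _ _)) (((iβ _ _).add iβδ).const_mul δ) ?_
    rw [EventuallyLE, ae_restrict_iff' measurableSet_Icc]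
    filter_upwards [hinc δ hδ.1] with τ hτ hm
    exact hτ (has.trans_le hm.1) (by linarith [hm.2, hδ.2])
  rw [intervalIntegral.integral_sub iγδ (iγ _ _), intervalIntegral.integral_const_mul,
    intervalIntegral.integral_add (iβ _ _) iβδ, intervalIntegral.integral_comp_add_right,
    intervalIntegral.integral_comp_add_right,
    ← intervalIntegral.integral_interval_sub_left (iγ 0 _) (iγ 0 (s + δ)),
    ← intervalIntegral.integral_interval_sub_left (iγ 0 t) (iγ 0 s),
    ← intervalIntegral.integral_interval_sub_left (iβ 0 (t + δ)) (iβ 0 (s + δ))] at hle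
  rw [smul_eq_mul, smul_eq_mul, ← mul_sub, inv_mul_le_iff₀ hδ.1]
  linarith

variable {E : Type*} [NormedAddCommGroup E]

/-- The Cauchy–Schwarz inequality for the integral of a square integrable curve. -/
theorem sq_norm_integral_le [NormedSpace ℝ E] {w : ℝ → E} (hw : MemLp w 2) (s t : ℝ) :
    ‖∫ τ in s..t, w τ‖ ^ 2 ≤
      |t - s| * |(∫ τ in (0 : ℝ)..t, ‖w τ‖ ^ 2) - ∫ τ in (0 : ℝ)..s, ‖w τ‖ ^ 2| := by
  have hw2 : Integrable fun τ => ‖w τ‖ ^ 2 := hw.integrable_norm_pow (by simp)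
  rw [intervalIntegral.integral_interval_sub_left hw2.intervalIntegrable hw2.intervalIntegrable]
  wlog hst : s ≤ t generalizing s t
  · have := this t s (le_of_not_ge hst)
    rwa [intervalIntegral.integral_symm, norm_neg, abs_sub_comm,
      intervalIntegral.integral_symm (f := fun τ => ‖w τ‖ ^ 2), abs_neg] at this
  rcases hst.eq_or_lt with rfl | hlt
  · simp
  have hpos : 0 < t - s := sub_pos.2 hlt
  have hw1 : IntervalIntegrable (fun τ => ‖w τ‖) volume s t := by
    rw [intervalIntegrable_iff_integrableOn_Ioc_of_le hst]
    exact ((hw.restrict (Ioc s t)).integrable (by norm_num)).norm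
  have hI : 0 ≤ ∫ τ in s..t, ‖w τ‖ ^ 2 :=
    intervalIntegral.integral_nonneg hst fun _ _ => by positivity
  rw [abs_of_pos hpos, abs_of_nonneg hI]
  -- With `m` the mean of `‖w‖`, the inequality is `∫ (‖w‖ - m)² ≥ 0` expanded.
  set m := (∫ τ in s..t, ‖w τ‖) / (t - s) with hm
  have hm' : (∫ τ in s..t, ‖w τ‖) = m * (t - s) := by rw [hm]; field_simp
  have h0 : 0 ≤ ∫ τ in s..t, (‖w τ‖ ^ 2 - 2 * m * ‖w τ‖ + m ^ 2) :=
    intervalIntegral.integral_nonneg hst fun τ _ => by nlinarith [sq_nonneg (‖w τ‖ - m)]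
  rw [intervalIntegral.integral_add (hw2.intervalIntegrable.sub (hw1.const_mul _)) (by simp),
    intervalIntegral.integral_sub hw2.intervalIntegrable (hw1.const_mul _),
    intervalIntegral.integral_const_mul, intervalIntegral.integral_const, hm', smul_eq_mul] at h0
  have h1 : ‖∫ τ in s..t, w τ‖ ≤ m * (t - s) :=
    hm' ▸ intervalIntegral.norm_integral_le_integral_norm hst
  calc ‖∫ τ in s..t, w τ‖ ^ 2 ≤ (m * (t - s)) ^ 2 := by gcongr
    _ ≤ (t - s) * ∫ τ in s..t, ‖w τ‖ ^ 2 := by nlinarith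

variable [InnerProductSpace ℝ E]
  {X : Type*} [NormedAddCommGroup X] [InnerProductSpace ℝ X] [CompleteSpace X]

/-- Let `v` be a curve in `X` whose image in `E` is a primitive of a square integrable `w` and for
which `⟪v t, ·⟫` is represented in `E` by a square integrable `b`. Then `v` agrees almost everywhere
with a curve that is continuous in `X`. -/
theorem exists_continuousOn_of_inner_eq (ι : X →ₗ[ℝ] E) {T : ℝ} (hT : 0 < T) {b w : ℝ → E}
    {v : ℝ → X} {c : E} (hb : MemLp b 2) (hw : MemLp w 2)
    (hg : LocallyIntegrable fun t => ‖v t‖ ^ 2)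
    (hv : ∀ᵐ t, t ∈ Ioo 0 T → (∀ φ : X, inner ℝ (v t) φ = inner ℝ (b t) (ι φ)) ∧
      ι (v t) = c + ∫ s in (0 : ℝ)..t, w s) :
    ∃ u : ℝ → X, ContinuousOn u (Icc 0 T) ∧ ∀ᵐ t, t ∈ Ioo 0 T → u t = v t := by
  have iβ : Integrable fun τ => ‖b τ‖ ^ 2 := hb.integrable_norm_pow (by simp)
  have iω : Integrable fun τ => ‖w τ‖ ^ 2 := hw.integrable_norm_pow (by simp)
  have iw : ∀ x y, IntervalIntegrable w volume x y := fun x y => by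
    rw [intervalIntegrable_iff]
    rw [IntegrableOn, uIoc]
    exact (hw.restrict _).integrable (by norm_num)
  set B : ℝ → ℝ := fun t => ∫ τ in (0 : ℝ)..t, ‖b τ‖ ^ 2 with hBdef
  set M : ℝ → ℝ := fun t => ∫ τ in (0 : ℝ)..t, ‖w τ‖ ^ 2 with hMdef
  have hBc : Continuous B := intervalIntegral.continuous_primitive
    (fun _ _ => iβ.intervalIntegrable) 0
  have hMc : Continuous M := intervalIntegral.continuous_primitive
    (fun _ _ => iω.intervalIntegrable) 0
  have hBsub : ∀ x y, B y - B x = ∫ τ in x..y, ‖b τ‖ ^ 2 := fun x y =>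
    intervalIntegral.integral_interval_sub_left iβ.intervalIntegrable iβ.intervalIntegrable
  have hMmono : Monotone M := fun x y hxy => by
    rw [← sub_nonneg]
    simp only [hMdef]
    rw [intervalIntegral.integral_interval_sub_left iω.intervalIntegrable iω.intervalIntegrable]
    exact intervalIntegral.integral_nonneg hxy fun _ _ => by positivity
  have hBmono : Monotone B := fun x y hxy => by
    rw [← sub_nonneg, hBsub]
    exact intervalIntegral.integral_nonneg hxy fun _ _ => by positivity
  set P : ℝ → Prop := fun t => (∀ φ : X, inner ℝ (v t) φ = inner ℝ (b t) (ι φ)) ∧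
      ι (v t) = c + ∫ s in (0 : ℝ)..t, w s with hP
  have hD : ∀ {s t}, P s → P t → ι (v t - v s) = ∫ τ in s..t, w τ := fun {s t} hs ht => by
    rw [map_sub, hs.2, ht.2, add_sub_add_left_eq_sub,
      intervalIntegral.integral_interval_sub_left (iw _ _) (iw _ _)]
  have hdiff : ∀ {s t}, P s → P t →
      ‖v t‖ ^ 2 - ‖v s‖ ^ 2 = inner ℝ (b t + b s) (∫ τ in s..t, w τ) := fun {s t} hs ht => by
    rw [← hD hs ht, inner_add_left, ← ht.1, ← hs.1, inner_sub_right, inner_sub_right,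
      real_inner_self_eq_norm_sq, real_inner_self_eq_norm_sq, real_inner_comm (v t) (v s)]
    ring
  have hinc : ∀ {s t}, P s → P t → s < t → |‖v t‖ ^ 2 - ‖v s‖ ^ 2| ≤
      (t - s) * (‖b s‖ ^ 2 + ‖b t‖ ^ 2) + (M t - M s) := fun {s t} hs ht hst => by
    have hδ : 0 < t - s := sub_pos.2 hst
    have hm : 0 ≤ M t - M s := sub_nonneg.2 (hMmono hst.le)
    have h1 := sq_norm_integral_le hw s t
    rw [abs_of_pos hδ] at h1
    change _ ≤ _ * |M t - M s| at h1
    rw [abs_of_nonneg hm] at h1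
    have h2 : ‖b t + b s‖ ≤ ‖b t‖ + ‖b s‖ := norm_add_le _ _
    set d := ‖∫ τ in s..t, w τ‖ with hd
    have h3 : |‖v t‖ ^ 2 - ‖v s‖ ^ 2| ≤ (‖b t‖ + ‖b s‖) * d := by
      rw [hdiff hs ht]
      exact (abs_real_inner_le_norm _ _).trans (by gcongr)
    refine h3.trans ?_
    have h4 : (t - s) * ((‖b t‖ + ‖b s‖) * d) ≤
        (t - s) * ((t - s) * (‖b s‖ ^ 2 + ‖b t‖ ^ 2) + (M t - M s)) := by
      nlinarith [sq_nonneg ((t - s) * ‖b t‖ - d), sq_nonneg ((t - s) * ‖b s‖ - d),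
        sq_nonneg ((t - s) * ‖b t‖), sq_nonneg ((t - s) * ‖b s‖)]
    exact le_of_mul_le_mul_left h4 hδ
  have hMl : LocallyIntegrable M := hMc.locallyIntegrable
  -- Subtracting `M` absorbs the term `M t - M s`, leaving the form required by the averaging lemma;
  -- the two signs give the upper and lower bounds.
  set γ₁ : ℝ → ℝ := fun t => ‖v t‖ ^ 2 - M t with hγ₁
  set γ₂ : ℝ → ℝ := fun t => -‖v t‖ ^ 2 - M t with hγ₂
  have hγ₁i : LocallyIntegrable γ₁ := hg.sub hMl
  have hγ₂i : LocallyIntegrable γ₂ := hg.neg.sub hMl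
  have hshift : ∀ δ > 0, ∀ᵐ τ, 0 < τ → τ + δ < T → P τ ∧ P (τ + δ) := fun δ hδ => by
    have h2 := (measurePreserving_add_right volume δ).quasiMeasurePreserving.ae hv
    filter_upwards [hv, h2] with τ h3 h4 h5 h6
    exact ⟨h3 ⟨h5, by linarith⟩, h4 ⟨by linarith, h6⟩⟩
  set S : Set ℝ := Ioo 0 T ∩ {t | P t ∧
    HasDerivAt (fun x => ∫ τ in (0 : ℝ)..x, γ₁ τ) (γ₁ t) t ∧
    HasDerivAt (fun x => ∫ τ in (0 : ℝ)..x, γ₂ τ) (γ₂ t) t} with hS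
  have hSae : ∀ᵐ t, t ∈ Ioo 0 T → t ∈ S := by
    filter_upwards [hv, _root_.LocallyIntegrable.ae_hasDerivAt_integral hγ₁i,
      _root_.LocallyIntegrable.ae_hasDerivAt_integral hγ₂i] with t h1 h2 h3 h4
    exact ⟨h4, h1 h4, h2 0, h3 0⟩
  set K : ℝ → ℝ := fun t => 2 * B t + M t with hK
  have hKc : Continuous K := (continuous_const.mul hBc).add hMc
  have hgK : ∀ {s t}, s ∈ S → t ∈ S → |‖v t‖ ^ 2 - ‖v s‖ ^ 2| ≤ |K t - K s| := by
    intro s t hs ht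
    wlog hst : s ≤ t generalizing s t
    · rw [abs_sub_comm, abs_sub_comm (K t)]
      exact this ht hs (le_of_not_ge hst)
    rcases hst.eq_or_lt with rfl | hlt
    · simp
    have e1 := sub_le_two_mul_integral_of_increment_le hγ₁i iβ.locallyIntegrable (a := 0) (b := T)
      (fun δ hδ => (hshift δ hδ).mono fun τ h1 h2 h3 => by
        have := (abs_le.1 (hinc (h1 h2 h3).1 (h1 h2 h3).2 (by linarith))).2
        simp only [hγ₁]; simp only [add_sub_cancel_left] at this; linarith)
      hs.1.1 hlt ht.1.2 hs.2.2.1 ht.2.2.1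
    have e2 := sub_le_two_mul_integral_of_increment_le hγ₂i iβ.locallyIntegrable (a := 0) (b := T)
      (fun δ hδ => (hshift δ hδ).mono fun τ h1 h2 h3 => by
        have := (abs_le.1 (hinc (h1 h2 h3).1 (h1 h2 h3).2 (by linarith))).1
        simp only [hγ₂]; simp only [add_sub_cancel_left] at this; linarith)
      hs.1.1 hlt ht.1.2 hs.2.2.2 ht.2.2.2
    rw [← hBsub] at e1 e2
    simp only [hγ₁, hγ₂] at e1 e2
    refine le_trans (abs_le.2 ⟨?_, ?_⟩) (le_abs_self _) <;> simp only [hK] <;> linarith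
  have hlim : ∀ t₀ ∈ Icc 0 T, ∀ ε > 0, ∃ s : ℝ, ∃ δ > 0, ∀ t ∈ S, |t - t₀| < δ →
      ‖v t - v s‖ ^ 2 ≤ 8 * ε := by
    intro t₀ ht₀ ε hε
    obtain ⟨δ₁, hδ₁, hB1⟩ := Metric.continuous_iff.1 hBc t₀ (ε / 2) (by positivity)
    obtain ⟨δ₂, hδ₂, hM1⟩ := Metric.continuous_iff.1 hMc t₀ (ε / 2) (by positivity)
    obtain ⟨δ₃, hδ₃, hK1⟩ := Metric.continuous_iff.1 hKc t₀ (ε / 2) (by positivity)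
    simp only [Real.dist_eq] at hB1 hM1 hK1
    obtain ⟨δ, hδ, hδm⟩ := exists_between (show 0 < min (min δ₁ δ₂) (min δ₃ T) by positivity)
    simp only [lt_min_iff] at hδm
    obtain ⟨⟨l1, l2⟩, l3, l4⟩ := hδm
    -- This places an interval of length `δ` inside `[0, T]` around `t₀`, endpoints of `[0, T]`
    -- included.
    set a := t₀ - δ * (t₀ / T) with ha
    have q0 : 0 ≤ t₀ / T := div_nonneg ht₀.1 hT.le
    have q1 : t₀ / T ≤ 1 := (div_le_one hT).2 ht₀.2
    have qt : t₀ = T * (t₀ / T) := by field_simp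
    have a0 : 0 ≤ a := by nlinarith
    have a1 : a + δ ≤ T := by nlinarith
    have a2 : a ≤ t₀ := by nlinarith
    have a3 : t₀ ≤ a + δ := by nlinarith
    -- A function is at most its average somewhere off any null set, so `s` can be taken in `S`.
    have hIS : ∃ s ∈ S, s ∈ Ioo a (a + δ) ∧ ‖b s‖ ^ 2 ≤ δ⁻¹ * (B (a + δ) - B a) := by
      have hne : (volume.restrict (Ioo a (a + δ)) : Measure ℝ) ≠ 0 := by
        rw [Ne, Measure.restrict_eq_zero, Real.volume_Ioo]
        simp [hδ]
      obtain ⟨s, hs, hle⟩ := exists_notMem_null_le_average hne iβ.restrict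
        (N := {s | ¬ (s ∈ S ∧ s ∈ Ioo a (a + δ))}) (by
          rw [← ae_iff, ae_restrict_iff' measurableSet_Ioo]
          filter_upwards [hSae] with s h1 h2
          exact ⟨h1 ⟨a0.trans_lt h2.1, h2.2.trans_le a1⟩, h2⟩)
      simp only [mem_ofPred_eq, not_not] at hs
      refine ⟨s, hs.1, hs.2, hle.trans_eq ?_⟩
      rw [setAverage_eq, hBsub, intervalIntegral.integral_of_le (by linarith),
        integral_Ioc_eq_integral_Ioo, smul_eq_mul, Measure.real, Real.volume_Ioo,
        ENNReal.toReal_ofReal (by linarith), add_sub_cancel_left]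
    obtain ⟨s, hsS, hsI, hbs⟩ := hIS
    refine ⟨s, δ, hδ, fun t htS ht => ?_⟩
    have hs1 : |s - t₀| < δ := abs_lt.2 ⟨by linarith [hsI.1], by linarith [hsI.2]⟩
    have hts : |t - s| ≤ 2 * δ := by
      have := abs_sub_le t t₀ s
      rw [abs_sub_comm t₀ s] at this
      linarith
    have hKts : |K t - K s| ≤ ε := by
      have := abs_sub_le (K t) (K t₀) (K s)
      rw [abs_sub_comm (K t₀)] at this
      linarith [hK1 t (ht.trans l3), hK1 s (hs1.trans l3)]
    have hMts : |M t - M s| ≤ ε := by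
      have := abs_sub_le (M t) (M t₀) (M s)
      rw [abs_sub_comm (M t₀)] at this
      linarith [hM1 t (ht.trans l2), hM1 s (hs1.trans l2)]
    have hBI : B (a + δ) - B a ≤ ε + ε := by
      have h2 := (abs_lt.1 (hB1 (t₀ + (δ₁ + δ) / 2) (by
        rw [add_sub_cancel_left, abs_of_pos (by linarith)]; linarith))).2
      have h3 := (abs_lt.1 (hB1 (t₀ - (δ₁ + δ) / 2) (by
        rw [sub_sub_cancel_left, abs_neg, abs_of_pos (by linarith)]; linarith))).1
      have h4 := hBmono (show a + δ ≤ t₀ + (δ₁ + δ) / 2 by linarith)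
      have h5 := hBmono (show t₀ - (δ₁ + δ) / 2 ≤ a by linarith)
      linarith
    have hd := sq_norm_integral_le hw s t
    change _ ≤ _ * |M t - M s| at hd
    have hkey : ‖v t - v s‖ ^ 2 =
        (‖v t‖ ^ 2 - ‖v s‖ ^ 2) - 2 * inner ℝ (b s) (∫ τ in s..t, w τ) := by
      rw [← hD hsS.2.1 htS.2.1, ← hsS.2.1.1, inner_sub_right, real_inner_self_eq_norm_sq,
        norm_sub_sq_real, real_inner_comm (v t) (v s)]
      ring
    have h1 := (abs_le.1 (hgK hsS htS)).2
    have h2 := (abs_le.1 (abs_real_inner_le_norm (b s) (∫ τ in s..t, w τ))).1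
    -- The factor `δ⁻¹` in the bound for `‖b s‖²` cancels the length `|t - s| ≤ 2δ` from
    -- Cauchy–Schwarz.
    have h3 : ‖b s‖ * ‖∫ τ in s..t, w τ‖ ≤ 3 * ε := by
      refine abs_le_of_sq_le_sq' ?_ (by positivity) |>.2
      rw [mul_pow]
      calc ‖b s‖ ^ 2 * ‖∫ τ in s..t, w τ‖ ^ 2
          ≤ (δ⁻¹ * (ε + ε)) * (2 * δ * ε) :=
            mul_le_mul (hbs.trans (by gcongr)) (hd.trans (by gcongr)) (by positivity)
              (by positivity)
        _ = 4 * ε ^ 2 := by field_simp; ring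
        _ ≤ (3 * ε) ^ 2 := by nlinarith [sq_nonneg ε]
    rw [hkey]
    linarith
  have hcl : Icc 0 T ⊆ closure S := by
    have hdense : Dense {t | t ∈ Ioo 0 T → t ∈ S} := Measure.dense_of_ae hSae
    rw [← closure_Ioo hT.ne]
    refine closure_minimal ((isOpen_Ioo.subset_interior_iff.2 Subset.rfl).trans ?_) isClosed_closure
    rw [isOpen_Ioo.interior_eq]
    exact (hdense.open_subset_closure_inter isOpen_Ioo).trans
      (closure_mono fun t ht => ht.2 ht.1)
  have hex : ∀ t₀ ∈ Icc 0 T, ∃ y, Tendsto v (𝓝[S] t₀) (𝓝 y) := by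
    intro t₀ ht₀
    have : (𝓝[S] t₀).NeBot := mem_closure_iff_nhdsWithin_neBot.1 (hcl ht₀)
    rw [← cauchy_map_iff_exists_tendsto, Metric.cauchy_iff]
    refine ⟨inferInstance, fun ε hε => ?_⟩
    -- Chosen so that `8 * (ε ^ 2 / 128) = (ε / 4) ^ 2`.
    obtain ⟨s, δ, hδ, hs⟩ := hlim t₀ ht₀ (ε ^ 2 / 128) (by positivity)
    refine ⟨v '' (S ∩ Metric.ball t₀ δ), image_mem_map
      (inter_mem self_mem_nhdsWithin (mem_nhdsWithin_of_mem_nhds (Metric.ball_mem_nhds _ hδ))), ?_⟩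
    have hb : ∀ t ∈ S ∩ Metric.ball t₀ δ, dist (v t) (v s) ≤ ε / 4 := fun t ht => by
      rw [dist_eq_norm]
      refine (abs_le_of_sq_le_sq' ?_ (by positivity)).2
      exact (hs t ht.1 (by simpa [Real.dist_eq] using ht.2)).trans_eq (by ring)
    rintro _ ⟨x, hx, rfl⟩ _ ⟨y, hy, rfl⟩
    linarith [dist_triangle_right (v x) (v y) (v s), hb x hx, hb y hy]
  refine ⟨extendFrom S v, continuousOn_extendFrom hcl hex, ?_⟩
  filter_upwards [hSae] with t h1 h2
  obtain ⟨y, hy⟩ := hex t (Ioo_subset_Icc_self h2)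
  rw [extendFrom_eq (subset_closure (h1 h2)) hy]
  exact (tendsto_nhds_unique (hy.mono_left (pure_le_nhdsWithin (h1 h2)))
    (tendsto_pure_nhds v t))

end Energy

/-! ### The inner product of `V` on `D(A)` -/

section Application

variable {G₂ : Set Plane} {h : ℝ}

/-- The map from `V` to `L²(G)` that forgets the gradient. -/
noncomputable def V.fieldL (G₂ : Set Plane) (h : ℝ) : V G₂ h →L[ℝ] L2 G₂ h :=
  (WithLp.fstL 2 ℝ (L2 G₂ h) (PiLp 2 (fun _ : Fin 3 => L2 G₂ h))).comp (V G₂ h).subtypeL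

/-- On `D(A)` the inner product of `V` is given by the operator `I + A`. -/
theorem inner_eq_inner_field_add_opA {u : V G₂ h} (hu : u ∈ domA G₂ h) (φ : V G₂ h) :
    inner ℝ u φ = inner ℝ (V.field u + (opA u : L2 G₂ h)) (V.field φ) := by
  have hlap : IsLaplacian u (lap u) := by
    have hu' : ∃ g, IsLaplacian u g := hu
    rw [lap, dif_pos hu']
    exact hu'.choose_spec
  suffices hJ : ∀ ψ ∈ V G₂ h, inner ℝ (u : Jet G₂ h) ψ =
      inner ℝ (V.field u + (opA u : L2 G₂ h)) ψ.fst from hJ φ φ.2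
  intro ψ hψ
  -- Both sides are continuous and linear in `ψ`, so fields of `𝒱` suffice. These lie in `H`, so the
  -- projection in `A` drops out and Green's formula applies.
  have hcl : IsClosed {ψ : Jet G₂ h | inner ℝ (u : Jet G₂ h) ψ =
      inner ℝ (V.field u + (opA u : L2 G₂ h)) ψ.fst} :=
    isClosed_eq (by fun_prop) (continuous_const.inner
      (WithLp.fstL 2 ℝ (L2 G₂ h) (PiLp 2 (fun _ : Fin 3 => L2 G₂ h))).continuous)
  refine closure_minimal (fun ψ hψ => ?_) hcl hψ
  rw [mem_ofPred_eq]
  induction hψ using Submodule.span_induction with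
  | mem ψ hψ =>
    obtain ⟨φ, hφ, h1, h2⟩ := hψ
    have hH : ψ.fst ∈ H G₂ h := subset_closure (Submodule.subset_span ⟨φ, hφ, h1⟩)
    have hA : inner ℝ (opA u : L2 G₂ h) ψ.fst = -inner ℝ (lap u) ψ.fst := by
      rw [opA, Submodule.coe_neg, inner_neg_left]
      exact congrArg Neg.neg
        ((H G₂ h).inner_orthogonalProjectionOnto_eq_of_mem_right ⟨ψ.fst, hH⟩ (lap u))
    rw [WithLp.prod_inner_apply, inner_add_left, hA, PiLp.inner_apply]
    refine congrArg₂ (· + ·) rfl ?_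
    have hg := hlap φ hφ.toIsTestField
    refine (Finset.sum_congr rfl fun i _ => ?_).trans (hg.trans (congrArg Neg.neg ?_))
    · rw [L2.inner_def]
      refine integral_congr_ae ?_
      filter_upwards [h2 i] with x hx
      rw [← hx]; rfl
    · rw [L2.inner_def]
      refine integral_congr_ae ?_
      filter_upwards [h1] with x hx
      rw [← hx]
  | zero => simp
  | add x y _ _ hx hy => rw [inner_add_right, hx, hy, WithLp.add_fst, inner_add_right]
  | smul a x _ hx => rw [inner_smul_right, hx, WithLp.smul_fst, inner_smul_right]

end Application

end PrimitiveEq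

/-! ### Continuity of strong solutions and the initial value -/

theorem mainTheorem7 (G₂ : Set PrimitiveEq.Plane) (hG₂ : PrimitiveEq.IsSmoothBoundedDomain G₂)
    (h : ℝ) (hh : 0 < h) (ν : ℝ) (hν : 0 < ν) (T : ℝ) (hT : 0 < T)
    (f v₀ : PrimitiveEq.H G₂ h) (v : ℝ → PrimitiveEq.V G₂ h)
    (hv : PrimitiveEq.IsStrongSolution G₂ h ν T f v₀ v) :
    ∃ u : ℝ → PrimitiveEq.V G₂ h, ContinuousOn u (Icc 0 T) ∧
      (∀ᵐ t ∂(volume.restrict (Icc 0 T)), u t = v t) ∧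
      PrimitiveEq.V.field (u 0) = v₀ := by
  open PrimitiveEq in
  obtain ⟨w, hw, hwd, -⟩ := hv.equation
  have hres : volume.restrict (Icc 0 T) = volume.restrict (Ioo (0 : ℝ) T) :=
    Measure.restrict_congr_set Ioo_ae_eq_Icc.symm
  have htop := hv.memLp_top
  have hdom := hv.mem_domA
  have hA := hv.memLp_opA
  rw [hres] at htop hdom hA hw
  rw [ae_restrict_iff' measurableSet_Ioo] at hdom
  have hv2 : MemLp v 2 (volume.restrict (Ioo 0 T)) := htop.mono_exponent le_top
  have hF : MemLp (fun t => V.field (v t)) 2 (volume.restrict (Ioo 0 T)) :=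
    (V.fieldL G₂ h).comp_memLp' hv2
  have hA' : MemLp (fun t => (opA (v t) : L2 G₂ h)) 2 (volume.restrict (Ioo 0 T)) :=
    (H G₂ h).subtypeL.comp_memLp' hA
  have hw' : MemLp (fun t => (w t : L2 G₂ h)) 2 (volume.restrict (Ioo 0 T)) :=
    (H G₂ h).subtypeL.comp_memLp' hw
  obtain ⟨c, hc⟩ := hwd.ae_eq_const_add_integral hT (hF.integrable (by norm_num))
    (hw'.integrable (by norm_num))
  have hg : LocallyIntegrable fun t => ‖(Ioo 0 T).indicator v t‖ ^ 2 :=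
    (((memLp_indicator_iff_restrict measurableSet_Ioo).2 hv2).integrable_norm_pow
      (by simp)).locallyIntegrable
  -- Extension by zero outside `(0, T)` makes `b = v + Av` and `w` square integrable on the whole
  -- line.
  obtain ⟨u, hu, huv⟩ := exists_continuousOn_of_inner_eq (V.fieldL G₂ h).toLinearMap hT (c := c)
    ((memLp_indicator_iff_restrict measurableSet_Ioo).2 (hF.add hA'))
    ((memLp_indicator_iff_restrict measurableSet_Ioo).2 hw') hg (by
      filter_upwards [hc, hdom] with t h1 h2 ht
      rw [indicator_of_mem ht, indicator_of_mem ht]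
      refine ⟨fun φ => inner_eq_inner_field_add_opA (h2 ht) φ, (h1 ht).trans ?_⟩
      congr 1
      refine intervalIntegral.integral_congr_ae (Eventually.of_forall fun s hs => ?_)
      rw [uIoc_of_le ht.1.le] at hs
      have hsT : s ∈ Ioo 0 T := ⟨hs.1, hs.2.trans_lt ht.2⟩
      simp only [indicator_of_mem hsT])
  have huv' : ∀ᵐ t, t ∈ Ioo 0 T → u t = v t := by
    filter_upwards [huv] with t h1 ht
    rw [h1 ht, indicator_of_mem ht]
  refine ⟨u, hu, ?_, ?_⟩
  · rw [hres, ae_restrict_iff' measurableSet_Ioo]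
    exact huv'
  -- Intervals `(0, x)` have positive measure, so the essential limit at `0` is unique; `u` and `v`
  -- share it in `L²(G)`.
  have hne : (𝓝[>] (0 : ℝ) ⊓ ae volume).NeBot := by
    rw [inf_neBot_iff]
    intro s hs s' hs'
    obtain ⟨x, hx, hxs⟩ := mem_nhdsGT_iff_exists_Ioo_subset.1 hs
    by_contra hempty
    have h0 : volume (Ioo 0 x) = 0 := measure_mono_null (fun y hy => by
      intro hy'
      exact hempty ⟨y, hxs hy, hy'⟩) (mem_ae_iff.1 hs')
    rw [Real.volume_Ioo, sub_zero, ENNReal.ofReal_eq_zero] at h0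
    exact absurd h0 (not_le.2 hx)
  refine tendsto_nhds_unique (f := fun t => V.field (v t)) (l := 𝓝[>] (0 : ℝ) ⊓ ae volume) ?_
    hv.initial
  have hI : ∀ᶠ t in 𝓝[>] (0 : ℝ), t ∈ Ioo 0 T := Ioo_mem_nhdsGT hT
  have h1 : Tendsto u (𝓝[>] 0) (𝓝 (u 0)) :=
    (hu 0 ⟨le_rfl, hT.le⟩).mono_left (nhdsWithin_le_iff.2 (mem_of_superset (Ioo_mem_nhdsGT hT)
      Ioo_subset_Icc_self))
  have h2 : Tendsto (fun t => V.field (u t)) (𝓝[>] (0 : ℝ) ⊓ ae volume) (𝓝 (V.field (u 0))) :=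
    (((V.fieldL G₂ h).continuous.tendsto (u 0)).comp h1).mono_left inf_le_left
  refine h2.congr' ?_
  filter_upwards [mem_inf_of_left hI, mem_inf_of_right huv'] with t h3 h4
  rw [h4 h3]
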